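/- Let $U\subseteq\mathbb R^n$ be open, let $m\ge 1$, and let $F=A^{1/m}$ be an $m$-th root Finsler metric on $U$. That is, $A(x,y)=a_{i_1\dots i_m}(x)\,y^{i_1}\cdots y^{i_m}\ge 0$ with $a_{i_1\dots i_m}$ symmetric in its indices, $F$ is $C^\infty$ on $\{(x,y): x\in U,\ y\ne 0\}$ and positively $1$-homogeneous in $y$, and $g_{ij}=\tfrac12\partial^2F^2/\partial y^i\partial y^j$ is positive definite for $y\neq 0$. Put $$G^i=\tfrac14 g^{il}\Big(\frac{\partial^2F^2}{\partial x^k\partial y^l}y^k-\frac{\partial F^2}{\partial x^l}\Big),\qquad E_{jk}=\tfrac12\frac{\partial^3G^i}{\partial y^j\partial y^k\partial y^i},\qquad h_{jk}=g_{jk}-F_{y^j}F_{y^k},$$ $$\tau(x,y)=\ln\Big[\frac{\sqrt{\det (g_{ij}(x,y))}}{\mathrm{Vol}(B^n(1))}\,\mathrm{Vol}\{z\in\mathbb R^n: F(x,z)<1\}\Big],\qquad \mathbf S(x,y)=\frac{d}{dt}\Big|_{t=0}\tau(\sigma(t),\dot\sigma(t)),$$ where $\sigma$ is the geodesic ($\ddot\sigma^i+2G^i(\sigma,\dot\sigma)=0$)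 with $\sigma(0)=x$, $\dot\sigma(0)=y$. All identities below are meant for all $x\in U$ and $y\ne0$; $c$ denotes a scalar function $c=c(x)$ on $U$. (i) For every $1$-form $\eta=\eta_i(x)y^i$ on $U$ the following are equivalent: (ia) $\mathbf S=(n+1)cF+\eta$ for some $c$; (ib) $\mathbf S=\eta$. Moreover, if $n\ge1$, every $c$ as in (ia) vanishes identically on $U$. (ii) The following are equivalent: (iia) $\mathbf E=\frac{n+1}{2}\,c\,F^{-1}\mathbf h$ for some $c$; (iia$'$) $\mathbf E=\frac{n+1}{2}\,c\,F\,\mathbf h$ for some $c$; (iib) $\mathbf E=0$, i.e. $F$ is weakly Berwald. Moreover, if $n\ge2$, every $c$ as in (iia) or (iia$'$) vanishes identically on $U$. -/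

import Mathlib

open scoped ContDiff

noncomputable section

namespace MRoot

/-- Coordinate space `ℝⁿ`; points `x` and tangent vectors `y` both live here. -/
abbrev Vec (n : ℕ) : Type := EuclideanSpace ℝ (Fin n)

variable {n : ℕ}

/-- `∂f/∂xⁱ` for a function `f(x, y)`. -/
def partialX (i : Fin n) (f : Vec n → Vec n → ℝ) (x y : Vec n) : ℝ :=
  fderiv ℝ (fun z => f z y) x (EuclideanSpace.single i 1)

/-- `∂f/∂yⁱ` for a function `f(x, y)`. -/
def partialY (i : Fin n) (f : Vec n → Vec n → ℝ) (x y : Vec n) : ℝ :=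
  fderiv ℝ (fun z => f x z) y (EuclideanSpace.single i 1)

/-- The fundamental tensor `g_ij = (1/2) ∂²F²/∂yⁱ∂yʲ`. -/
def fundamentalTensor (F : Vec n → Vec n → ℝ) (x y : Vec n) : Matrix (Fin n) (Fin n) ℝ :=
  Matrix.of fun i j => (1 / 2) * partialY i (partialY j fun x y => F x y ^ 2) x y

/-- `F` is a Finsler metric on `U ⊆ ℝⁿ`: nonnegative, smooth on the slit tangent bundle,
positively 1-homogeneous on the fibres, with positive definite fundamental tensor. -/
structure IsFinslerMetricOn (U : Set (Vec n)) (F : Vec n → Vec n → ℝ) : Prop where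
  nonneg : ∀ x ∈ U, ∀ y, 0 ≤ F x y
  smooth : ContDiffOn ℝ ∞ (fun p : Vec n × Vec n => F p.1 p.2) (U ×ˢ {y | y ≠ 0})
  homogeneous : ∀ x ∈ U, ∀ y, ∀ r : ℝ, 0 < r → F x (r • y) = r * F x y
  posDef : ∀ x ∈ U, ∀ y, y ≠ 0 → (fundamentalTensor F x y).PosDef

/-- `A(x, y) = a_{i₁…i_m}(x) y^{i₁} ⋯ y^{i_m}`. -/
def rootForm {m : ℕ} (a : Vec n → (Fin m → Fin n) → ℝ) (x y : Vec n) : ℝ :=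
  ∑ I : Fin m → Fin n, a x I * ∏ k, y (I k)

/-- `F = A^{1/m}`. -/
def rootMetric {m : ℕ} (a : Vec n → (Fin m → Fin n) → ℝ) (x y : Vec n) : ℝ :=
  rootForm a x y ^ (1 / (m : ℝ))

/-- The coefficients `a` define an `m`-th root Finsler metric `F = A^{1/m}` on `U`.
The condition `0 ≤ A` says that the real `m`-th root is a genuine nonnegative root. -/
structure IsRootFinslerMetricOn (U : Set (Vec n)) {m : ℕ}
    (a : Vec n → (Fin m → Fin n) → ℝ) : Prop where
  pos : 0 < m
  symmetric : ∀ x ∈ U, ∀ (π : Equiv.Perm (Fin m)) (I : Fin m → Fin n), a x (I ∘ π) = a x I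
  nonneg : ∀ x ∈ U, ∀ y, 0 ≤ rootForm a x y
  finsler : IsFinslerMetricOn U (rootMetric a)

/-- The spray coefficients
`Gⁱ = (1/4) g^{il} (∂²F²/∂xᵏ∂yˡ yᵏ - ∂F²/∂xˡ)`. -/
def sprayCoeff (F : Vec n → Vec n → ℝ) (i : Fin n) (x y : Vec n) : ℝ :=
  (1 / 4) * ∑ l, (fundamentalTensor F x y)⁻¹ i l *
    ((∑ k, partialX k (partialY l fun x y => F x y ^ 2) x y * y k)
      - partialX l (fun x y => F x y ^ 2) x y)

/-- The vector `(G¹, …, Gⁿ)`. -/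
def spray (F : Vec n → Vec n → ℝ) (x y : Vec n) : Vec n :=
  WithLp.toLp 2 fun i => sprayCoeff F i x y

/-- `σ` is, on the interval `(-ε, ε)`, a geodesic of `F` in `U` with (nowhere zero) velocity `v`:
`σ'' + 2 G(σ, σ') = 0`. -/
def IsGeodesicOn (U : Set (Vec n)) (F : Vec n → Vec n → ℝ) (ε : ℝ) (σ v : ℝ → Vec n) : Prop :=
  ∀ t ∈ Set.Ioo (-ε) ε, σ t ∈ U ∧ v t ≠ 0 ∧ HasDerivAt σ (v t) t ∧
    HasDerivAt v (-((2 : ℝ) • spray F (σ t) (v t))) t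

/-- `σ`, with velocity `v`, is a geodesic defined near `0` with `σ(0) = x`, `σ'(0) = y`. -/
def IsGeodesicFrom (U : Set (Vec n)) (F : Vec n → Vec n → ℝ) (x y : Vec n)
    (σ v : ℝ → Vec n) : Prop :=
  σ 0 = x ∧ v 0 = y ∧ ∃ ε > 0, IsGeodesicOn U F ε σ v

/-- The distortion
`τ(x, y) = ln [ √det(g_ij(x, y)) / Vol(Bⁿ(1)) · Vol {z ∈ ℝⁿ | F(x, z) < 1} ]`. -/
def distortion (F : Vec n → Vec n → ℝ) (x y : Vec n) : ℝ :=
  Real.log (√(fundamentalTensor F x y).det /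
      (MeasureTheory.volume (Metric.ball (0 : Vec n) 1)).toReal *
    (MeasureTheory.volume {z : Vec n | F x z < 1}).toReal)

/-- `S(x, y) = s`: there is a geodesic `σ` with `σ(0) = x`, `σ'(0) = y`, and for every such
geodesic the derivative of `t ↦ τ(σ(t), σ'(t))` at `t = 0` exists and equals `s`. -/
def HasSCurvatureAt (U : Set (Vec n)) (F : Vec n → Vec n → ℝ) (x y : Vec n) (s : ℝ) : Prop :=
  (∃ σ v, IsGeodesicFrom U F x y σ v) ∧
    ∀ σ v, IsGeodesicFrom U F x y σ v → HasDerivAt (fun t => distortion F (σ t) (v t)) s 0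

/-- `S = φ` on the slit tangent bundle of `U`. -/
def SCurvatureEq (U : Set (Vec n)) (F φ : Vec n → Vec n → ℝ) : Prop :=
  ∀ x ∈ U, ∀ y, y ≠ 0 → HasSCurvatureAt U F x y (φ x y)

/-- The Berwald curvature `Bⁱ_jkl = ∂³Gⁱ/∂yʲ∂yᵏ∂yˡ`. -/
def berwald (F : Vec n → Vec n → ℝ) (i j k l : Fin n) (x y : Vec n) : ℝ :=
  partialY j (partialY k (partialY l (sprayCoeff F i))) x y

/-- The mean Berwald curvature `E_jk = (1/2) Bᵐ_jkm`. -/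
def meanBerwald (F : Vec n → Vec n → ℝ) (j k : Fin n) (x y : Vec n) : ℝ :=
  (1 / 2) * ∑ i, berwald F i j k i x y

/-- The angular metric `h_jk = g_jk - (∂F/∂yʲ)(∂F/∂yᵏ)`, which equals `F ∂²F/∂yʲ∂yᵏ`. -/
def angularMetric (F : Vec n → Vec n → ℝ) (j k : Fin n) (x y : Vec n) : ℝ :=
  fundamentalTensor F x y j k - partialY j F x y * partialY k F x y

/-- `E = f h` on the slit tangent bundle of `U`, for a scalar factor `f(x, y)`. -/
def MeanBerwaldEqAngular (U : Set (Vec n)) (F f : Vec n → Vec n → ℝ) : Prop :=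
  ∀ x ∈ U, ∀ y, y ≠ 0 → ∀ j k, meanBerwald F j k x y = f x y * angularMetric F j k x y

/-- `F` is weakly Berwald on `U`: `E = 0`. -/
def IsWeaklyBerwald (U : Set (Vec n)) (F : Vec n → Vec n → ℝ) : Prop :=
  ∀ x ∈ U, ∀ y, y ≠ 0 → ∀ j k, meanBerwald F j k x y = 0

end MRoot

end

/-! The argument is a parity count in `y`. Replacing `y` by `-y` multiplies `A` by `(-1) ^ m`, so `0
≤ A` with `m` odd would force `A = 0`, against positive definiteness once `1 ≤ n`. Hence `m` is even
and `F` is reversible. Then `G` is even, so its third derivatives, and with them `E`, are odd;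
reversing geodesics shows that `S` is odd. But `c F` and `c F^{±1} h` are even, so they vanish
(`SCurvatureEq.evenPart_eq_zero`, `MeanBerwaldEqAngular.evenPart_eq_zero`). To get `c = 0` it
remains to find `y` with `F ≠ 0`, and for `E` also `h ≠ 0`, which is where `2 ≤ n` enters. -/

namespace MRoot

section Parity

variable {n : ℕ} {F : Vec n → Vec n → ℝ}

lemma partialY_even {f : Vec n → Vec n → ℝ} (hf : ∀ x y, f x (-y) = f x y) (i : Fin n)
    (x y : Vec n) : partialY i f x (-y) = -partialY i f x y := by
  -- This rescaling rule needs no differentiability, so parity passes to derivatives without any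
  -- smoothness assumption.
  have h := fderiv_comp_smul (f := fun z => f x z) (x := y) (-1 : ℝ)
  simp only [neg_smul, one_smul, hf] at h
  simp [partialY, h]

lemma partialY_odd {f : Vec n → Vec n → ℝ} (hf : ∀ x y, f x (-y) = -f x y) (i : Fin n)
    (x y : Vec n) : partialY i f x (-y) = partialY i f x y := by
  have h := fderiv_comp_smul (f := fun z => f x z) (x := y) (-1 : ℝ)
  simp only [neg_smul, one_smul, hf, fderiv_fun_neg] at h
  simp [partialY, neg_inj.mp h]

lemma partialX_even {f : Vec n → Vec n → ℝ} (hf : ∀ x y, f x (-y) = f x y) (i : Fin n)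
    (x y : Vec n) : partialX i f x (-y) = partialX i f x y := by
  simp [partialX, hf]

lemma partialX_odd {f : Vec n → Vec n → ℝ} (hf : ∀ x y, f x (-y) = -f x y) (i : Fin n)
    (x y : Vec n) : partialX i f x (-y) = -partialX i f x y := by
  simp [partialX, hf, fderiv_fun_neg]

lemma sq_even (hF : ∀ x y, F x (-y) = F x y) (x y : Vec n) : F x (-y) ^ 2 = F x y ^ 2 := by
  rw [hF]

lemma fundamentalTensor_even (hF : ∀ x y, F x (-y) = F x y) (x y : Vec n) :
    fundamentalTensor F x (-y) = fundamentalTensor F x y := by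
  ext i j
  simp only [fundamentalTensor, Matrix.of_apply]
  rw [partialY_odd (partialY_even (f := fun x y => F x y ^ 2) (sq_even hF) j)]

lemma sprayCoeff_even (hF : ∀ x y, F x (-y) = F x y) (i : Fin n) (x y : Vec n) :
    sprayCoeff F i x (-y) = sprayCoeff F i x y := by
  have hX := partialX_even (f := fun x y => F x y ^ 2) (sq_even hF)
  have hXY := fun l => partialX_odd (partialY_even (f := fun x y => F x y ^ 2) (sq_even hF) l)
  simp only [sprayCoeff, fundamentalTensor_even hF, hX, hXY, PiLp.neg_apply, neg_mul_neg]

lemma spray_even (hF : ∀ x y, F x (-y) = F x y) (x y : Vec n) :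
    spray F x (-y) = spray F x y := by
  simp only [spray, sprayCoeff_even hF]

lemma distortion_even (hF : ∀ x y, F x (-y) = F x y) (x y : Vec n) :
    distortion F x (-y) = distortion F x y := by
  simp only [distortion, fundamentalTensor_even hF]

lemma meanBerwald_odd (hF : ∀ x y, F x (-y) = F x y) (j k : Fin n) (x y : Vec n) :
    meanBerwald F j k x (-y) = -meanBerwald F j k x y := by
  have h : ∀ i, berwald F i j k i x (-y) = -berwald F i j k i x y := fun i =>
    partialY_even (partialY_odd (partialY_even (sprayCoeff_even hF i) i) k) j x y
  simp only [meanBerwald, h, Finset.sum_neg_distrib, mul_neg]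

lemma angularMetric_even (hF : ∀ x y, F x (-y) = F x y) (j k : Fin n) (x y : Vec n) :
    angularMetric F j k x (-y) = angularMetric F j k x y := by
  simp only [angularMetric, fundamentalTensor_even hF, partialY_even hF, neg_mul_neg]

/-- Geodesics of a reversible metric are reversible. -/
lemma IsGeodesicFrom.reverse {U : Set (Vec n)} (hF : ∀ x y, F x (-y) = F x y) {x y : Vec n}
    {σ v : ℝ → Vec n} (h : IsGeodesicFrom U F x y σ v) :
    IsGeodesicFrom U F x (-y) (fun t => σ (-t)) (fun t => -v (-t)) := by
  obtain ⟨h0, h1, ε, hε, h⟩ := h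
  refine ⟨by simpa using h0, by simpa using h1, ε, hε, fun t ht => ?_⟩
  obtain ⟨hU, hv, hσ, hv'⟩ := h (-t) ⟨by linarith [ht.2], by linarith [ht.1]⟩
  refine ⟨hU, neg_ne_zero.mpr hv, ?_, ?_⟩
  · simpa [Function.comp_def] using hσ.scomp t (hasDerivAt_neg t)
  -- Time reversal flips the velocity twice, so the acceleration keeps its sign, as does the even
  -- spray.
  · simpa [spray_even hF, Function.comp_def] using (hv'.scomp t (hasDerivAt_neg t)).fun_neg

/-- The `S`-curvature of a reversible metric is odd. -/
lemma HasSCurvatureAt.add_eq_zero {U : Set (Vec n)} (hF : ∀ x y, F x (-y) = F x y) {x y : Vec n}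
    {s s' : ℝ} (h : HasSCurvatureAt U F x y s) (h' : HasSCurvatureAt U F x (-y) s') :
    s + s' = 0 := by
  obtain ⟨⟨σ, v, hσ⟩, hs⟩ := h
  have h1 := h'.2 _ _ (hσ.reverse hF)
  simp only [distortion_even hF] at h1
  -- The base point is written `-0` to match the chain rule for `t ↦ -t` at `0`.
  have h2 : HasDerivAt (fun t => distortion F (σ t) (v t)) s (-(0 : ℝ)) := by
    simpa using hs σ v hσ
  have h3 := h1.unique (h2.scomp (0 : ℝ) (hasDerivAt_neg (0 : ℝ)))
  simp only [smul_eq_mul, neg_mul, one_mul] at h3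
  linarith

/-- For a reversible metric, `S` has no even part. -/
lemma SCurvatureEq.evenPart_eq_zero {U : Set (Vec n)} (hF : ∀ x y, F x (-y) = F x y)
    {c : Vec n → ℝ} {η : Vec n → (Vec n →L[ℝ] ℝ)}
    (h : SCurvatureEq U F fun x y => (n + 1 : ℝ) * c x * F x y + η x y)
    {x y : Vec n} (hx : x ∈ U) (hy : y ≠ 0) : c x * F x y = 0 := by
  have h0 := (h x hx y hy).add_eq_zero hF (h x hx (-y) (neg_ne_zero.mpr hy))
  simp only [hF, map_neg] at h0
  have hn : (n + 1 : ℝ) ≠ 0 := by positivity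
  refine (mul_eq_zero.mp (?_ : (n + 1 : ℝ) * (c x * F x y) = 0)).resolve_left hn
  linarith

/-- For a reversible metric, `E` has no even part. -/
lemma MeanBerwaldEqAngular.evenPart_eq_zero {U : Set (Vec n)} (hF : ∀ x y, F x (-y) = F x y)
    {f : Vec n → Vec n → ℝ} (hf : ∀ x y, f x (-y) = f x y) (h : MeanBerwaldEqAngular U F f)
    {x y : Vec n} (hx : x ∈ U) (hy : y ≠ 0) (j k : Fin n) :
    f x y * angularMetric F j k x y = 0 := by
  have h1 := h x hx y hy j k
  have h2 := h x hx (-y) (neg_ne_zero.mpr hy) j k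
  rw [meanBerwald_odd hF, hf, angularMetric_even hF] at h2
  linarith

end Parity

section Finsler

variable {n : ℕ} {F : Vec n → Vec n → ℝ} {U : Set (Vec n)}

lemma IsFinslerMetricOn.zero (hF : IsFinslerMetricOn U F) {x : Vec n} (hx : x ∈ U) :
    F x 0 = 0 := by
  have h := hF.homogeneous x hx 0 2 two_pos
  rw [smul_zero] at h
  linarith

/-- If `F` vanished on a whole fibre, so would `g`, which is positive definite. -/
lemma IsFinslerMetricOn.exists_ne_zero (hF : IsFinslerMetricOn U F) (hn : 1 ≤ n) {x : Vec n}
    (hx : x ∈ U) : ∃ y, y ≠ 0 ∧ F x y ≠ 0 := by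
  have : Nonempty (Fin n) := ⟨⟨0, hn⟩⟩
  by_contra! h
  have h0 : ∀ y, F x y = 0 := fun y => by
    by_cases hy : y = 0
    · rw [hy, hF.zero hx]
    · exact h y hy
  obtain ⟨y, hy⟩ := exists_ne (0 : Vec n)
  have hg : fundamentalTensor F x y = 0 := by
    ext i j
    simp [fundamentalTensor, partialY, h0]
  have hp := (hF.posDef x hx y hy).diag_pos (i := ⟨0, hn⟩)
  simp [hg] at hp

/-- In dimension at least two the angular metric does not vanish, having rank `n - 1`. -/
lemma IsFinslerMetricOn.exists_angularMetric_ne_zero (hF : IsFinslerMetricOn U F) (hn : 2 ≤ n)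
    {x y : Vec n} (hx : x ∈ U) (hy : y ≠ 0) : ∃ j k, angularMetric F j k x y ≠ 0 := by
  by_contra! h
  have hg : ∀ j k, fundamentalTensor F x y j k = partialY j F x y * partialY k F x y :=
    fun j k => sub_eq_zero.mp (h j k)
  have hdet := (hF.posDef x hx y hy).det_pos
  -- If `h = 0`, then `g` is the outer product of the `y`-gradient of `F` with itself, which is
  -- singular in size at least two.
  have hM : fundamentalTensor F x y =
      Matrix.vecMulVec (fun j => partialY j F x y) (fun k => partialY k F x y) := by
    ext j k
    rw [hg, Matrix.vecMulVec_apply]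
  have : Nontrivial (Fin n) := Fin.nontrivial_iff_two_le.mpr hn
  rw [hM, Matrix.det_vecMulVec] at hdet
  exact lt_irrefl _ hdet

end Finsler

section RootMetric

variable {n m : ℕ} {a : Vec n → (Fin m → Fin n) → ℝ} {U : Set (Vec n)}

lemma rootForm_neg (a : Vec n → (Fin m → Fin n) → ℝ) (x y : Vec n) :
    rootForm a x (-y) = (-1) ^ m * rootForm a x y := by
  simp only [rootForm, PiLp.neg_apply, Finset.prod_neg, Finset.card_univ, Fintype.card_fin,
    Finset.mul_sum]
  exact Finset.sum_congr rfl fun I _ => by ring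

/-- The degree of a root metric is even, since `A` takes no negative values. -/
lemma IsRootFinslerMetricOn.even (ha : IsRootFinslerMetricOn U a) (hn : 1 ≤ n) {x : Vec n}
    (hx : x ∈ U) : Even m := by
  by_contra hm
  obtain ⟨y, -, hy⟩ := ha.finsler.exists_ne_zero hn hx
  have h := rootForm_neg a x y
  rw [(Nat.not_even_iff_odd.mp hm).neg_one_pow] at h
  have h0 : rootForm a x y = 0 := by
    linarith [ha.nonneg x hx y, ha.nonneg x hx (-y)]
  have hm0 : (1 / (m : ℝ)) ≠ 0 := one_div_ne_zero (Nat.cast_ne_zero.mpr ha.pos.ne')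
  exact hy (by rw [rootMetric, h0, Real.zero_rpow hm0])

/-- One point of `U` suffices to fix the parity of `m`, so the symmetry then holds on every fibre.
-/
lemma IsRootFinslerMetricOn.reversible (ha : IsRootFinslerMetricOn U a) (hn : 1 ≤ n) {x : Vec n}
    (hx : x ∈ U) (z y : Vec n) : rootMetric a z (-y) = rootMetric a z y := by
  rw [rootMetric, rootForm_neg, (ha.even hn hx).neg_one_pow, one_mul, rootMetric]

/-- In dimension zero the identities are vacuous; this lets the equivalences hold for all `n`. -/
lemma one_le_of_ne_zero {y : Vec n} (hy : y ≠ 0) : 1 ≤ n := by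
  rcases Nat.eq_zero_or_pos n with rfl | h
  · exact absurd (Subsingleton.elim y 0) hy
  · exact h

lemma IsRootFinslerMetricOn.eq_zero_of_sCurvatureEq (ha : IsRootFinslerMetricOn U a) (hn : 1 ≤ n)
    {c : Vec n → ℝ} {η : Vec n → (Vec n →L[ℝ] ℝ)}
    (h : SCurvatureEq U (rootMetric a) fun x y => (n + 1 : ℝ) * c x * rootMetric a x y + η x y)
    {x : Vec n} (hx : x ∈ U) : c x = 0 := by
  obtain ⟨y, hy, hFy⟩ := ha.finsler.exists_ne_zero hn hx
  exact (mul_eq_zero.mp (h.evenPart_eq_zero (ha.reversible hn hx) hx hy)).resolve_right hFy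

/-- Isotropic mean Berwald curvature, with a factor `c φ(F)` for an arbitrary `φ`, vanishes. -/
lemma IsRootFinslerMetricOn.isWeaklyBerwald (ha : IsRootFinslerMetricOn U a) (φ : ℝ → ℝ)
    {c : Vec n → ℝ}
    (h : MeanBerwaldEqAngular U (rootMetric a)
      fun x y => (n + 1 : ℝ) / 2 * c x * φ (rootMetric a x y)) :
    IsWeaklyBerwald U (rootMetric a) := fun x hx y hy j k => by
  have hF := ha.reversible (one_le_of_ne_zero hy) hx
  rw [h x hx y hy j k]
  exact h.evenPart_eq_zero hF (fun x y => by rw [hF]) hx hy j k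

/-- The even term is zero, and its other factors can be cancelled at a single `y`. Taking `φ` to be
inversion or the identity covers both normalisations. -/
lemma IsRootFinslerMetricOn.eq_zero_of_meanBerwaldEqAngular (ha : IsRootFinslerMetricOn U a)
    (hn : 2 ≤ n) {φ : ℝ → ℝ} (hφ : ∀ r, r ≠ 0 → φ r ≠ 0) {c : Vec n → ℝ}
    (h : MeanBerwaldEqAngular U (rootMetric a)
      fun x y => (n + 1 : ℝ) / 2 * c x * φ (rootMetric a x y))
    {x : Vec n} (hx : x ∈ U) : c x = 0 := by
  have hn1 : 1 ≤ n := one_le_two.trans hn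
  have hF := ha.reversible hn1 hx
  obtain ⟨y, hy, hFy⟩ := ha.finsler.exists_ne_zero hn1 hx
  obtain ⟨j, k, hjk⟩ := ha.finsler.exists_angularMetric_ne_zero hn hx hy
  have h0 := h.evenPart_eq_zero hF (fun x y => by rw [hF]) hx hy j k
  have h1 := ((mul_eq_zero.mp ((mul_eq_zero.mp h0).resolve_right hjk)).resolve_right (hφ _ hFy))
  have hn2 : (n + 1 : ℝ) / 2 ≠ 0 := by positivity
  exact (mul_eq_zero.mp h1).resolve_left hn2

lemma IsWeaklyBerwald.exists_meanBerwaldEqAngular {F : Vec n → Vec n → ℝ}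
    (h : IsWeaklyBerwald U F) (φ : ℝ → ℝ) :
    ∃ c : Vec n → ℝ,
      MeanBerwaldEqAngular U F fun x y => (n + 1 : ℝ) / 2 * c x * φ (F x y) :=
  ⟨fun _ => 0, fun x hx y hy j k => by simp [h x hx y hy j k]⟩

end RootMetric

end MRoot

theorem theorem1p1 {n m : ℕ} (U : Set (MRoot.Vec n)) (hU : IsOpen U)
    (a : MRoot.Vec n → (Fin m → Fin n) → ℝ) (ha : MRoot.IsRootFinslerMetricOn U a) :
    -- (i) `S = (n+1) c F + η` for some `c` iff `S = η`; moreover such a `c` vanishes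
    (∀ η : MRoot.Vec n → (MRoot.Vec n →L[ℝ] ℝ),
      ((∃ c : MRoot.Vec n → ℝ, MRoot.SCurvatureEq U (MRoot.rootMetric a)
          (fun x y => (n + 1 : ℝ) * c x * MRoot.rootMetric a x y + η x y)) ↔
        MRoot.SCurvatureEq U (MRoot.rootMetric a) (fun x y => η x y)) ∧
      (1 ≤ n → ∀ c : MRoot.Vec n → ℝ, MRoot.SCurvatureEq U (MRoot.rootMetric a)
          (fun x y => (n + 1 : ℝ) * c x * MRoot.rootMetric a x y + η x y) →
        ∀ x ∈ U, c x = 0)) ∧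
    -- (ii) `E = (n+1)/2 c F⁻¹ h` for some `c` iff `E = 0`; moreover such a `c` vanishes if `n ≥ 2`
    (((∃ c : MRoot.Vec n → ℝ, MRoot.MeanBerwaldEqAngular U (MRoot.rootMetric a)
          (fun x y => (n + 1 : ℝ) / 2 * c x * (MRoot.rootMetric a x y)⁻¹)) ↔
        MRoot.IsWeaklyBerwald U (MRoot.rootMetric a)) ∧
      (2 ≤ n → ∀ c : MRoot.Vec n → ℝ, MRoot.MeanBerwaldEqAngular U (MRoot.rootMetric a)
          (fun x y => (n + 1 : ℝ) / 2 * c x * (MRoot.rootMetric a x y)⁻¹) →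
        ∀ x ∈ U, c x = 0)) ∧
    -- the same with `E = (n+1)/2 c F h`
    (((∃ c : MRoot.Vec n → ℝ, MRoot.MeanBerwaldEqAngular U (MRoot.rootMetric a)
          (fun x y => (n + 1 : ℝ) / 2 * c x * MRoot.rootMetric a x y)) ↔
        MRoot.IsWeaklyBerwald U (MRoot.rootMetric a)) ∧
      (2 ≤ n → ∀ c : MRoot.Vec n → ℝ, MRoot.MeanBerwaldEqAngular U (MRoot.rootMetric a)
          (fun x y => (n + 1 : ℝ) / 2 * c x * MRoot.rootMetric a x y) →
        ∀ x ∈ U, c x = 0)) := by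
  refine ⟨fun η => ⟨⟨?_, ?_⟩, fun hn c h x hx => ha.eq_zero_of_sCurvatureEq hn h hx⟩,
    ⟨⟨fun ⟨_, h⟩ => ha.isWeaklyBerwald (fun r => r⁻¹) h,
        fun h => h.exists_meanBerwaldEqAngular (fun r => r⁻¹)⟩,
      fun hn _ h _ hx =>
        ha.eq_zero_of_meanBerwaldEqAngular (φ := fun r => r⁻¹) hn (fun _ => inv_ne_zero) h hx⟩,
    ⟨⟨fun ⟨_, h⟩ => ha.isWeaklyBerwald (fun r => r) h,
        fun h => h.exists_meanBerwaldEqAngular (fun r => r)⟩,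
      fun hn _ h _ hx =>
        ha.eq_zero_of_meanBerwaldEqAngular (φ := fun r => r) hn (fun _ => id) h hx⟩⟩
  · rintro ⟨c, h⟩ x hx y hy
    have hc := ha.eq_zero_of_sCurvatureEq (MRoot.one_le_of_ne_zero hy) h hx
    simpa [hc] using h x hx y hy
  · exact fun h => ⟨fun _ => 0, fun x hx y hy => by simpa using h x hx y hy⟩
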